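/- Let $K$ be a finite (abstract) simplicial complex, partially ordered by the face relation $\le$, and let $H_*$ denote simplicial homology with coefficients in a fixed finite field. For $A\subseteq K$ put $\operatorname{cl}(A)=\{\tau\in K : \tau\le\sigma \text{ for some } \sigma\in A\}$ and $\operatorname{mo}(A)=\operatorname{cl}(A)\setminus A$; $A$ is closed if $A=\operatorname{cl}(A)$, and convex if $\sigma\le\rho\le\tau$ with $\sigma,\tau\in A$ implies $\rho\in A$. Let $\mathcal V$ be a multivector field on $K$, i.e. a partition of $K$ into (non-empty) convex sets, called multivectors; let $[\sigma]$ be the multivector containing $\sigma$, and let $F(\sigma)=\operatorname{cl}(\sigma)\cup[\sigma]$ and $F(A)=\bigcup_{\sigma\in A}F(\sigma)$. A multivector $V$ is critical if $H_k(\operatorname{cl}(V),\operatorname{mo}(V))\neq0$ for some $k$. A path is a finite sequence $\rho(0),\dots,\rho(n)$ ($n\ge 0$) in $K$ with $\rho(i+1)\in F(\rho(i))$ for $0\le i<n$; a solution is a map $\rho:\mathbb Z\to K$ with $\rho(i+1)\in F(\rho(i))$ for all $i$. A solution is essential if for every $i$ such that $[\rho(i)]$ is not critical there are $i^-<i<i^+$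 with $[\rho(i^-)]\ne[\rho(i)]\ne[\rho(i^+)]$. For $A\subseteq K$, $\operatorname{inv}(A)$ is the set of $\sigma\in A$ that lie on an essential solution $\mathbb Z\to A$. A set $S\subseteq K$ is an isolated invariant set if $S=\operatorname{inv}(S)$ and there is a closed set $N\subseteq K$ such that $F(S)\subseteq N$ and every path in $N$ with both endpoints in $S$ lies in $S$. An index pair for an isolated invariant set $S$ is a pair $(P,E)$ of closed subsets of $K$ with $E\subseteq P$, $F(P\setminus E)\subseteq P$, $F(E)\cap P\subseteq E$ and $S=\operatorname{inv}(P\setminus E)$; its $k$-dimensional Conley index is $H_k(P,E)$. **Theorem.** Let $(P,E)$ and $(P',E')$ be index pairs for the same isolated invariant set $S$ under $\mathcal V$, with $P'\subseteq P$ and $E'\subseteq E$. Then for every $k\ge0$ the inclusion $(P',E')\hookrightarrow(P,E)$ induces an isomorphism $H_k(P',E')\to H_k(P,E)$. -/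

import Mathlib

set_option maxSynthPendingDepth 3

namespace ConleyIndex

universe u v

noncomputable section

/-! ### Simplicial homology of pairs

Simplices are non-empty finite sets of vertices.  The vertices are linearly ordered, and every
simplex is oriented by its increasing order. -/

section Homology

variable (F : Type u) [Field F] {V : Type v}

/-- The simplicial `n`-chains of the complex `L`: formal linear combinations of its
`n`-dimensional simplices. -/
def chains (L : PreAbstractSimplicialComplex V) (n : ℕ) : Submodule F (Finset V →₀ F) :=
  Finsupp.supported F F {σ | σ ∈ L ∧ σ.card = n + 1}

theorem chains_mono {L L' : PreAbstractSimplicialComplex V} (h : L ≤ L') (n : ℕ) :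
    chains F L n ≤ chains F L' n :=
  Finsupp.supported_mono fun _ hσ => ⟨h hσ.1, hσ.2⟩

variable [LinearOrder V]

/-- The boundary of a simplex `σ = {v₀ < ⋯ < vₙ}`, that is `∑ᵢ (-1)ⁱ [σ \ {vᵢ}]`: the index `i` of
`v` in `σ` is the number of vertices of `σ` below `v`. -/
def simplexBoundary (σ : Finset V) : Finset V →₀ F :=
  ∑ v ∈ σ, Finsupp.single (σ.erase v) ((-1 : F) ^ (σ.filter (· < v)).card)

/-- The linear extension of the boundary of simplices.  It is used only on chains of
positive dimension. -/
def boundary : (Finset V →₀ F) →ₗ[F] (Finset V →₀ F) :=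
  Finsupp.linearCombination F (simplexBoundary F)

theorem boundary_single (σ : Finset V) (a : F) :
    boundary F (Finsupp.single σ a) = a • simplexBoundary F σ := by
  simp [boundary]

theorem boundary_simplexBoundary (σ : Finset V) :
    boundary F (simplexBoundary F σ) = 0 := by
  have h1 : boundary F (simplexBoundary F σ) =
      ∑ p ∈ σ.sigma (fun v => σ.erase v), Finsupp.single ((σ.erase p.1).erase p.2)
        ((-1 : F) ^ ((σ.filter (· < p.1)).card + ((σ.erase p.1).filter (· < p.2)).card)) := by
    rw [Finset.sum_sigma, simplexBoundary, map_sum]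
    refine Finset.sum_congr rfl fun v _ => ?_
    rw [boundary_single, simplexBoundary, Finset.smul_sum]
    refine Finset.sum_congr rfl fun w _ => ?_
    simp [pow_add]
  have key : ∀ v ∈ σ, ∀ w, w ∈ σ → w < v →
      (σ.filter (· < v)).card + ((σ.erase v).filter (· < w)).card =
        ((σ.filter (· < w)).card + ((σ.erase w).filter (· < v)).card) + 1 := by
    intro v hv w hw hwv
    have e1 : (σ.erase v).filter (· < w) = σ.filter (· < w) := by
      ext x
      simp only [Finset.mem_filter, Finset.mem_erase]
      constructor
      · rintro ⟨⟨_, h⟩, h'⟩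
        exact ⟨h, h'⟩
      · rintro ⟨h, h'⟩
        exact ⟨⟨(h'.trans hwv).ne, h⟩, h'⟩
    have e2 : (σ.erase w).filter (· < v) = (σ.filter (· < v)).erase w := by
      ext x
      simp only [Finset.mem_filter, Finset.mem_erase]
      tauto
    have hm : w ∈ σ.filter (· < v) := by simp [hw, hwv]
    rw [e1, e2]
    have := Finset.card_erase_add_one hm
    omega
  rw [h1]
  refine Finset.sum_involution (fun p _ => ⟨p.2, p.1⟩) ?_ ?_ ?_ ?_
  · rintro ⟨v, w⟩ hp
    simp only [Finset.mem_sigma, Finset.mem_erase] at hp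
    obtain ⟨hv, hwv, hw⟩ := hp
    simp only
    rw [Finset.erase_right_comm, ← Finsupp.single_add]
    rcases lt_or_gt_of_ne hwv with h | h
    · rw [key v hv w hw h, pow_succ]
      simp
    · rw [key w hw v hv h, pow_succ]
      simp
  · rintro ⟨v, w⟩ hp _ h
    simp only [Finset.mem_sigma, Finset.mem_erase] at hp
    simp only [Sigma.mk.injEq] at h
    exact hp.2.1 h.1
  · rintro ⟨v, w⟩ hp
    simp only [Finset.mem_sigma, Finset.mem_erase] at hp ⊢
    exact ⟨hp.2.2, hp.2.1.symm, hp.1⟩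
  · rintro ⟨v, w⟩ _
    rfl

theorem boundary_boundary (c : Finset V →₀ F) : boundary F (boundary F c) = 0 := by
  induction c using Finsupp.induction_linear with
  | zero => simp
  | add f g hf hg => rw [map_add, map_add, hf, hg, add_zero]
  | single σ a => rw [boundary_single, map_smul, boundary_simplexBoundary, smul_zero]

theorem boundary_mem_chains (L : PreAbstractSimplicialComplex V) (n : ℕ) :
    ∀ c ∈ chains F L (n + 1), boundary F c ∈ chains F L n := by
  intro c hc
  rw [boundary, Finsupp.linearCombination_apply]
  refine Submodule.sum_mem _ fun σ hσ => Submodule.smul_mem _ _ ?_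
  have hσ' : σ ∈ L ∧ σ.card = n + 1 + 1 := (Finsupp.mem_supported F c).1 hc hσ
  refine Submodule.sum_mem _ fun v hv => Finsupp.single_mem_supported F _ ?_
  have hcard : (σ.erase v).card = n + 1 := by
    rw [Finset.card_erase_of_mem hv, hσ'.2]
    rfl
  exact ⟨(L.isRelLowerSet_faces hσ'.1).2 (Finset.erase_subset v σ)
    (Finset.card_pos.1 (by omega)), hcard⟩

/-- The boundary operator from `(n+1)`-chains to `n`-chains of `L`. -/
def chainsBoundary (L : PreAbstractSimplicialComplex V) (n : ℕ) :
    chains F L (n + 1) →ₗ[F] chains F L n :=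
  (boundary F).restrict (boundary_mem_chains F L n)

/-- The `n`-chains of `L` that are carried by `M`, as a subspace of the `n`-chains of `L`. -/
def subChains (L M : PreAbstractSimplicialComplex V) (n : ℕ) : Submodule F (chains F L n) :=
  (chains F M n).comap (chains F L n).subtype

/-- The relative chains `Cₙ(L, M) = Cₙ(L) / Cₙ(M)`. -/
abbrev RelChains (L M : PreAbstractSimplicialComplex V) (n : ℕ) : Type (max u v) :=
  chains F L n ⧸ subChains F L M n

/-- The boundary operator of relative chains. -/
def relBoundary (L M : PreAbstractSimplicialComplex V) (n : ℕ) :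
    RelChains F L M (n + 1) →ₗ[F] RelChains F L M n :=
  Submodule.mapQ _ _ (chainsBoundary F L n) fun c hc =>
    boundary_mem_chains F M n (c : Finset V →₀ F) hc

theorem relBoundary_comp (L M : PreAbstractSimplicialComplex V) (n : ℕ) :
    relBoundary F L M n ∘ₗ relBoundary F L M (n + 1) = 0 := by
  refine Submodule.linearMap_qext _ (LinearMap.ext fun c => ?_)
  have h : chainsBoundary F L n (chainsBoundary F L (n + 1) c) = 0 :=
    Subtype.ext (boundary_boundary F (c : Finset V →₀ F))
  change Submodule.Quotient.mk (chainsBoundary F L n (chainsBoundary F L (n + 1) c)) = 0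
  rw [h]
  rfl

/-- The relative simplicial chain complex `C(L, M)` with coefficients in `F`. -/
def relComplex (L M : PreAbstractSimplicialComplex V) :
    ChainComplex (ModuleCat.{max u v} F) ℕ :=
  ChainComplex.of (fun n => ModuleCat.of F (RelChains F L M n))
    (fun n => ModuleCat.ofHom (relBoundary F L M n))
    (fun n => by rw [← ModuleCat.ofHom_comp, relBoundary_comp]; rfl)

theorem relComplex_d (L M : PreAbstractSimplicialComplex V) (n : ℕ) :
    (relComplex F L M).d (n + 1) n = ModuleCat.ofHom (relBoundary F L M n) :=
  ChainComplex.of_d (fun n => ModuleCat.of F (RelChains F L M n))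
    (fun n => ModuleCat.ofHom (relBoundary F L M n)) n

/-- The map on relative chains induced by an inclusion of pairs. -/
def relChainsMap {L M L' M' : PreAbstractSimplicialComplex V} (hL : L ≤ L') (hM : M ≤ M')
    (n : ℕ) : RelChains F L M n →ₗ[F] RelChains F L' M' n :=
  Submodule.mapQ _ _ (Submodule.inclusion (chains_mono F hL n)) fun _ hc =>
    chains_mono F hM n hc

theorem relChainsMap_comm {L M L' M' : PreAbstractSimplicialComplex V} (hL : L ≤ L')
    (hM : M ≤ M') (n : ℕ) :
    relBoundary F L' M' n ∘ₗ relChainsMap F hL hM (n + 1) =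
      relChainsMap F hL hM n ∘ₗ relBoundary F L M n :=
  Submodule.linearMap_qext _ (LinearMap.ext fun _ => rfl)

/-- The chain map `C(L, M) ⟶ C(L', M')` induced by an inclusion of pairs. -/
def relComplexMap {L M L' M' : PreAbstractSimplicialComplex V} (hL : L ≤ L') (hM : M ≤ M') :
    relComplex F L M ⟶ relComplex F L' M' :=
  ChainComplex.ofHom (fun n => ModuleCat.ofHom (relChainsMap F hL hM n))
    (fun n => by
      rw [relComplex_d, relComplex_d]
      exact ModuleCat.hom_ext (relChainsMap_comm F hL hM n))

/-- The relative simplicial homology `Hₖ(L, M)` with coefficients in `F`. -/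
def relHomology (L M : PreAbstractSimplicialComplex V) (k : ℕ) : ModuleCat.{max u v} F :=
  (relComplex F L M).homology k

/-- The map `Hₖ(L, M) ⟶ Hₖ(L', M')` induced by an inclusion of pairs. -/
def relHomologyMap {L M L' M' : PreAbstractSimplicialComplex V} (hL : L ≤ L') (hM : M ≤ M')
    (k : ℕ) : relHomology F L M k ⟶ relHomology F L' M' k :=
  HomologicalComplex.homologyMap (relComplexMap F hL hM) k

end Homology

/-! ### Closed sets, mouths and multivector fields

The set of simplices of `K` is the type `↥K`, ordered by the face relation.  Closed sets of
simplices are the lower sets of `↥K`, the closure is `lowerClosure`, and convex sets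
are the sets with `Set.OrdConnected`. -/

section Dynamics

variable {V : Type v} {K : PreAbstractSimplicialComplex V}

/-- A closed set of simplices, as a subcomplex of `K`. -/
def toComplex (A : LowerSet ↥K) : PreAbstractSimplicialComplex V where
  faces := Subtype.val '' (A : Set ↥K)
  isRelLowerSet_faces := by
    rintro _ ⟨σ, hσ, rfl⟩
    refine ⟨(K.isRelLowerSet_faces σ.2).1, fun τ hτ hne => ?_⟩
    exact ⟨⟨τ, (K.isRelLowerSet_faces σ.2).2 hτ hne⟩, A.lower hτ hσ, rfl⟩

theorem toComplex_mono {A B : LowerSet ↥K} (h : A ≤ B) : toComplex A ≤ toComplex B :=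
  fun _ hσ => Set.image_mono h hσ

/-- The mouth `cl A \ A` of a convex set `A` of simplices. It is closed, because `A` is convex. -/
def mouth (A : Set ↥K) (hA : A.OrdConnected) : LowerSet ↥K where
  carrier := (lowerClosure A : Set ↥K) \ A
  lower' := by
    rintro σ τ hτσ ⟨hσ, hσA⟩
    refine ⟨(lowerClosure A).lower hτσ hσ, fun hτA => hσA ?_⟩
    obtain ⟨ρ, hρ, hσρ⟩ := mem_lowerClosure.1 hσ
    exact hA.out hτA hρ ⟨hτσ, hσρ⟩

variable (K) in
/-- A multivector field on `K`: a partition of the set of simplices into convex sets. -/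
structure MultivectorField where
  /-- The multivectors. -/
  parts : Set (Set ↥K)
  isPartition : Setoid.IsPartition parts
  convex : ∀ W ∈ parts, W.OrdConnected

namespace MultivectorField

/-- The multivector `[σ]` that contains the simplex `σ`. -/
def block (𝒱 : MultivectorField K) (σ : ↥K) : Set ↥K :=
  (𝒱.isPartition.2 σ).choose

theorem block_mem_parts (𝒱 : MultivectorField K) (σ : ↥K) : 𝒱.block σ ∈ 𝒱.parts :=
  (𝒱.isPartition.2 σ).choose_spec.1.1

theorem mem_block (𝒱 : MultivectorField K) (σ : ↥K) : σ ∈ 𝒱.block σ :=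
  (𝒱.isPartition.2 σ).choose_spec.1.2

theorem block_convex (𝒱 : MultivectorField K) (σ : ↥K) : (𝒱.block σ).OrdConnected :=
  𝒱.convex _ (𝒱.block_mem_parts σ)

/-- The multivalued map `F(σ) = cl σ ∪ [σ]`. -/
def next (𝒱 : MultivectorField K) (σ : ↥K) : Set ↥K :=
  Set.Iic σ ∪ 𝒱.block σ

/-- The image `F(A)` of a set of simplices. -/
def image (𝒱 : MultivectorField K) (A : Set ↥K) : Set ↥K :=
  ⋃ σ ∈ A, 𝒱.next σ

/-- A path of length `n`. -/
def IsPath (𝒱 : MultivectorField K) {n : ℕ} (ρ : Fin (n + 1) → ↥K) : Prop :=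
  ∀ i : Fin n, ρ i.succ ∈ 𝒱.next (ρ i.castSucc)

/-- A solution. -/
def IsSolution (𝒱 : MultivectorField K) (ρ : ℤ → ↥K) : Prop :=
  ∀ i : ℤ, ρ (i + 1) ∈ 𝒱.next (ρ i)

end MultivectorField

/-- A convex set `W` of simplices is critical if `H(cl W, mo W) ≠ 0`. -/
def IsCritical (F : Type u) [Field F] [LinearOrder V] (W : Set ↥K) (hW : W.OrdConnected) : Prop :=
  ∃ k : ℕ, Nontrivial
    (relHomology F (toComplex (lowerClosure W)) (toComplex (mouth W hW)) k)

namespace MultivectorField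

variable (F : Type u) [Field F] [LinearOrder V]

/-- An essential solution: a solution that leaves every non-critical multivector it visits, both
in forward and in backward time. -/
def IsEssentialSolution (𝒱 : MultivectorField K) (ρ : ℤ → ↥K) : Prop :=
  𝒱.IsSolution ρ ∧
    ∀ i : ℤ, ¬ IsCritical F (𝒱.block (ρ i)) (𝒱.block_convex (ρ i)) →
      ∃ i₁ i₂ : ℤ, i₁ < i ∧ i < i₂ ∧
        𝒱.block (ρ i₁) ≠ 𝒱.block (ρ i) ∧ 𝒱.block (ρ i) ≠ 𝒱.block (ρ i₂)

/-- The invariant part of a set of simplices. -/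
def inv (𝒱 : MultivectorField K) (A : Set ↥K) : Set ↥K :=
  {σ | σ ∈ A ∧ ∃ ρ : ℤ → ↥K, 𝒱.IsEssentialSolution F ρ ∧ (∀ i, ρ i ∈ A) ∧ ∃ i, ρ i = σ}

/-- `S` is an invariant set. -/
def IsInvariant (𝒱 : MultivectorField K) (S : Set ↥K) : Prop :=
  S = 𝒱.inv F S

/-- The closed set `N` isolates the set `S`. -/
def Isolates (𝒱 : MultivectorField K) (N : LowerSet ↥K) (S : Set ↥K) : Prop :=
  𝒱.image S ⊆ N ∧
    ∀ (n : ℕ) (ρ : Fin (n + 1) → ↥K), 𝒱.IsPath ρ → (∀ i, ρ i ∈ N) →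
      ρ 0 ∈ S → ρ (Fin.last n) ∈ S → ∀ i, ρ i ∈ S

/-- `S` is an isolated invariant set. -/
def IsIsolatedInvariant (𝒱 : MultivectorField K) (S : Set ↥K) : Prop :=
  𝒱.IsInvariant F S ∧ ∃ N : LowerSet ↥K, 𝒱.Isolates N S

/-- The pair `(P, E)` of closed sets is an index pair for the isolated invariant set `S`. -/
structure IsIndexPair (𝒱 : MultivectorField K) (S : Set ↥K) (P E : LowerSet ↥K) : Prop where
  isolated : 𝒱.IsIsolatedInvariant F S
  subset : E ≤ P
  image_diff_subset : 𝒱.image ((P : Set ↥K) \ E) ⊆ P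
  image_inter_subset : 𝒱.image E ∩ P ⊆ E
  eq_inv : S = 𝒱.inv F ((P : Set ↥K) \ E)

end MultivectorField

/-- The `k`-dimensional Conley index `Hₖ(P, E)` given by the index pair `(P, E)`. -/
abbrev conleyIndex (F : Type u) [Field F] [LinearOrder V] (P E : LowerSet ↥K) (k : ℕ) :
    ModuleCat.{max u v} F :=
  relHomology F (toComplex P) (toComplex E) k

/-- The map on `k`-dimensional Conley indices induced by the inclusion `(P', E') ⊆ (P, E)`. -/
abbrev conleyIndexMap (F : Type u) [Field F] [LinearOrder V] {P' E' P E : LowerSet ↥K}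
    (hP : P' ≤ P) (hE : E' ≤ E) (k : ℕ) : conleyIndex F P' E' k ⟶ conleyIndex F P E k :=
  relHomologyMap F (toComplex_mono hP) (toComplex_mono hE) k

end Dynamics

end

end ConleyIndex

open CategoryTheory

/-! The inclusion factors as $(P',E')\subseteq(P',P'\cap E)\subseteq(P'\cup E,E)\subseteq(P,E)$. The
middle map is an excision, so it is enough that $H(P'\cap E,E')=0$ and $H(P,P'\cup E)=0$;
`isIso_relHomologyMap_of_isAcyclicPair` carries out this reduction directly on chains.

Now $(P'\cap E)\setminus E'=(P'\setminus E')\setminus(P\setminus E)$ and $P\setminus(P'\cup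
E)=(P\setminus E)\setminus(P'\setminus E')$. Both are unions of multivectors, and both have empty
invariant part: $P\setminus E$ and $P'\setminus E'$ have the same invariant part $S$, which is
contained in each of them.

What remains is `isAcyclicPair_of_inv_eq_empty`: $H(Q,R)=0$ if $Q\setminus R$ is a union of
multivectors with empty invariant part. Some multivector $W$ in $Q\setminus R$ has its mouth in $R$,
since otherwise descending from multivector to multivector would give an essential solution by
finiteness. Moreover $W$ is not critical, since constant solutions in critical multivectors are
essential. Hence $H(R\cup\operatorname{cl}W,R)\cong H(\operatorname{cl}W,\operatorname{mo}W)=0$, and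
$R$ can be enlarged to $R\cup\operatorname{cl}W$ until it fills $Q$. -/

/-- A self-map of a non-empty finite type has a full orbit. -/
theorem Function.exists_int_orbit {α : Type*} [Finite α] [Nonempty α] (f : α → α) :
    ∃ a : ℤ → α, ∀ i, a (i + 1) = f (a i) := by
  obtain ⟨x⟩ := ‹Nonempty α›
  obtain ⟨m, n, hmn, h⟩ : ∃ m n, m < n ∧ f^[m] x = f^[n] x := by
    obtain ⟨m, n, hne, h⟩ := Finite.exists_ne_map_eq_of_infinite fun n : ℕ => f^[n] x
    rcases lt_or_gt_of_ne hne with hlt | hlt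
    · exact ⟨m, n, hlt, h⟩
    · exact ⟨n, m, hlt, h.symm⟩
  -- On its periodic points `f` is a permutation, so the orbit extends to negative times.
  have hy : f^[m] x ∈ Function.periodicPts f := by
    refine ⟨n - m, by omega, ?_⟩
    rw [Function.IsPeriodicPt, Function.IsFixedPt, ← Function.iterate_add_apply,
      Nat.sub_add_cancel hmn.le, h]
  let e := Set.BijOn.equiv f (Function.bijOn_periodicPts f)
  refine ⟨fun i => ((e ^ i : Equiv.Perm _) ⟨_, hy⟩ : ↥(Function.periodicPts f)), fun i => ?_⟩
  beta_reduce
  rw [add_comm, zpow_add, zpow_one]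
  rfl

/-! ### Homology of complexes of modules in terms of elements -/

namespace CategoryTheory.ShortComplex

universe w w'

variable {R : Type w} [Ring R] {S S₁ S₂ : ShortComplex (ModuleCat.{w'} R)}

theorem moduleCat_exists_cycles (x : S.X₂) (hx : S.g x = 0) :
    ∃ z : S.cycles, S.iCycles z = x :=
  ⟨S.moduleCatCyclesIso.inv ⟨x, hx⟩, moduleCatCyclesIso_inv_iCycles_apply S ⟨x, hx⟩⟩

theorem moduleCat_iCycles_injective : Function.Injective S.iCycles :=
  (ModuleCat.mono_iff_injective _).1 inferInstance

theorem moduleCat_homologyπ_surjective : Function.Surjective S.homologyπ :=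
  (ModuleCat.epi_iff_surjective _).1 inferInstance

theorem moduleCat_g_iCycles (z : S.cycles) : S.g (S.iCycles z) = 0 := by
  rw [← ConcreteCategory.comp_apply, iCycles_g]
  rfl

theorem moduleCat_iCycles_toCycles (w : S.X₁) : S.iCycles (S.toCycles w) = S.f w := by
  rw [← ConcreteCategory.comp_apply, toCycles_i]

/-- A cycle has trivial homology class if and only if it is a boundary. -/
theorem moduleCat_homologyπ_eq_zero_iff (z : S.cycles) :
    S.homologyπ z = 0 ↔ ∃ w : S.X₁, S.f w = S.iCycles z := by
  have hex : (ShortComplex.mk S.toCycles S.homologyπ S.toCycles_comp_homologyπ).Exact :=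
    ShortComplex.exact_of_g_is_cokernel _ S.homologyIsCokernel
  constructor
  · intro h
    obtain ⟨w, hw⟩ := (moduleCat_exact_iff _).1 hex z h
    exact ⟨w, by rw [← moduleCat_iCycles_toCycles]; exact congrArg S.iCycles hw⟩
  · rintro ⟨w, hw⟩
    have : z = S.toCycles w := moduleCat_iCycles_injective (by
      rw [moduleCat_iCycles_toCycles, hw])
    rw [this, ← ConcreteCategory.comp_apply, toCycles_comp_homologyπ]
    rfl

theorem moduleCat_homologyMap_homologyπ (φ : S₁ ⟶ S₂) (z : S₁.cycles) :
    homologyMap φ (S₁.homologyπ z) = S₂.homologyπ (cyclesMap φ z) := by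
  rw [← ConcreteCategory.comp_apply, homologyπ_naturality, ConcreteCategory.comp_apply]

theorem moduleCat_iCycles_cyclesMap (φ : S₁ ⟶ S₂) (z : S₁.cycles) :
    S₂.iCycles (cyclesMap φ z) = φ.τ₂ (S₁.iCycles z) := by
  rw [← ConcreteCategory.comp_apply, cyclesMap_i, ConcreteCategory.comp_apply]

/-- A criterion in terms of elements for a map of complexes of modules to induce an isomorphism
in homology. -/
theorem moduleCat_isIso_homologyMap (φ : S₁ ⟶ S₂)
    (hinj : ∀ x : S₁.X₂, S₁.g x = 0 → (∃ w : S₂.X₁, S₂.f w = φ.τ₂ x) → ∃ w : S₁.X₁, S₁.f w = x)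
    (hsurj : ∀ y : S₂.X₂, S₂.g y = 0 →
      ∃ x : S₁.X₂, S₁.g x = 0 ∧ ∃ w : S₂.X₁, S₂.f w = φ.τ₂ x - y) :
    IsIso (homologyMap φ) := by
  have : Mono (homologyMap φ) := by
    rw [ModuleCat.mono_iff_injective]
    refine (injective_iff_map_eq_zero _).2 fun a ha => ?_
    obtain ⟨z, rfl⟩ := moduleCat_homologyπ_surjective a
    rw [moduleCat_homologyMap_homologyπ, moduleCat_homologyπ_eq_zero_iff,
      moduleCat_iCycles_cyclesMap] at ha
    exact (moduleCat_homologyπ_eq_zero_iff z).2 (hinj _ (moduleCat_g_iCycles z) ha)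
  have : Epi (homologyMap φ) := by
    rw [ModuleCat.epi_iff_surjective]
    intro b
    obtain ⟨z, rfl⟩ := moduleCat_homologyπ_surjective b
    obtain ⟨x, hx, w, hw⟩ := hsurj _ (moduleCat_g_iCycles z)
    obtain ⟨t, rfl⟩ := moduleCat_exists_cycles x hx
    refine ⟨S₁.homologyπ t, ?_⟩
    rw [moduleCat_homologyMap_homologyπ, ← sub_eq_zero, ← map_sub,
      moduleCat_homologyπ_eq_zero_iff]
    exact ⟨w, by rw [hw, map_sub, moduleCat_iCycles_cyclesMap]⟩
  exact isIso_of_mono_of_epi _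

theorem moduleCat_exists_of_subsingleton_homology (h : Subsingleton S.homology) (x : S.X₂)
    (hx : S.g x = 0) : ∃ w : S.X₁, S.f w = x := by
  obtain ⟨z, rfl⟩ := moduleCat_exists_cycles x hx
  exact (moduleCat_homologyπ_eq_zero_iff z).1 (Subsingleton.elim _ _)

end CategoryTheory.ShortComplex

namespace HomologicalComplex

universe w w' t

variable {R : Type w} [Ring R] {ι : Type t} {c : ComplexShape ι}
  {C D : HomologicalComplex (ModuleCat.{w'} R) c}

/-- The neighbours of `j` are free variables so that a degree such as `k + 1` can stand for `c.prev
k`. -/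
theorem moduleCat_isIso_homologyMap (φ : C ⟶ D) {i j k : ι} (hi : c.prev j = i)
    (hk : c.next j = k)
    (hinj : ∀ x : C.X j, C.d j k x = 0 → (∃ w : D.X i, D.d i j w = φ.f j x) →
      ∃ w : C.X i, C.d i j w = x)
    (hsurj : ∀ y : D.X j, D.d j k y = 0 →
      ∃ x : C.X j, C.d j k x = 0 ∧ ∃ w : D.X i, D.d i j w = φ.f j x - y) :
    IsIso (homologyMap φ j) := by
  subst hi hk
  exact ShortComplex.moduleCat_isIso_homologyMap ((shortComplexFunctor _ _ j).map φ) hinj hsurj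

theorem moduleCat_exists_of_subsingleton_homology {i j k : ι} (hi : c.prev j = i)
    (hk : c.next j = k) (h : Subsingleton (C.homology j)) (x : C.X j) (hx : C.d j k x = 0) :
    ∃ w : C.X i, C.d i j w = x := by
  subst hi hk
  exact ShortComplex.moduleCat_exists_of_subsingleton_homology (S := C.sc j) h x hx

end HomologicalComplex


namespace ConleyIndex

universe u v

/-! ### Relative simplicial homology in terms of chains -/

section Homology

variable (F : Type u) [Field F] {V : Type v} [LinearOrder V]

/-- The chain `c` of dimension `n` has its boundary in `M`; there is no condition for `n = 0`. -/
def HasBoundaryIn (M : PreAbstractSimplicialComplex V) (n : ℕ) (c : Finset V →₀ F) : Prop :=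
  ∀ m, n = m + 1 → boundary F c ∈ chains F M m

/-- The relative homology of `(L, M)` vanishes, in terms of chains: every relative cycle is a
relative boundary. -/
def IsAcyclicPair (L M : PreAbstractSimplicialComplex V) : Prop :=
  ∀ n, ∀ c ∈ chains F L n, HasBoundaryIn F M n c →
    ∃ b ∈ chains F L (n + 1), c - boundary F b ∈ chains F M n

variable {F}
variable {L M L' M' : PreAbstractSimplicialComplex V} {n : ℕ}

variable (F) in
/-- The class of a chain, as an element of the relative chain complex. -/
noncomputable def relMk (L M : PreAbstractSimplicialComplex V) (n : ℕ) (c : chains F L n) :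
    (relComplex F L M).X n :=
  (subChains F L M n).mkQ c

theorem relMk_surjective (L M : PreAbstractSimplicialComplex V) (n : ℕ) :
    Function.Surjective (relMk F L M n) :=
  (subChains F L M n).mkQ_surjective

theorem relMk_eq_iff (a c : chains F L n) :
    relMk F L M n a = relMk F L M n c ↔ (a : Finset V →₀ F) - c ∈ chains F M n :=
  Submodule.Quotient.eq (subChains F L M n)

theorem relMk_sub (a c : chains F L n) :
    relMk F L M n (a - c) = relMk F L M n a - relMk F L M n c :=
  map_sub (subChains F L M n).mkQ a c

theorem relComplex_d_relMk (c : chains F L (n + 1)) :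
    (relComplex F L M).d (n + 1) n (relMk F L M (n + 1) c) =
      relMk F L M n (chainsBoundary F L n c) := by
  rw [relComplex_d]
  rfl

theorem relComplexMap_f_relMk (hL : L ≤ L') (hM : M ≤ M') (c : chains F L n) :
    (relComplexMap F hL hM).f n (relMk F L M n c) =
      relMk F L' M' n (Submodule.inclusion (chains_mono F hL n) c) :=
  rfl

theorem relComplex_d_relMk_eq_zero_iff {m : ℕ} (hm : (ComplexShape.down ℕ).next n = m)
    (c : chains F L n) :
    (relComplex F L M).d n m (relMk F L M n c) = 0 ↔
      HasBoundaryIn F M n (c : Finset V →₀ F) := by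
  cases n with
  | zero =>
    -- No differential leaves degree `0`; accordingly `HasBoundaryIn` is vacuous there.
    have h : (relComplex F L M).d 0 m = 0 := (relComplex F L M).shape _ _ (by simp)
    rw [h]
    exact ⟨fun _ m hm => by omega, fun _ => rfl⟩
  | succ n =>
    obtain rfl : n = m := by simpa using hm
    have h0 : (0 : (relComplex F L M).X n) = relMk F L M n 0 :=
      (map_zero (subChains F L M n).mkQ).symm
    rw [relComplex_d_relMk, h0, relMk_eq_iff, ZeroMemClass.coe_zero, sub_zero]
    constructor
    · intro h m hm
      obtain rfl : n = m := by omega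
      exact h
    · intro h
      exact h n rfl

theorem exists_relComplex_d_eq_relMk_iff (c : chains F L n) :
    (∃ w, (relComplex F L M).d (n + 1) n w = relMk F L M n c) ↔
      ∃ b ∈ chains F L (n + 1), (c : Finset V →₀ F) - boundary F b ∈ chains F M n := by
  constructor
  · rintro ⟨w, hw⟩
    obtain ⟨b, rfl⟩ := relMk_surjective L M (n + 1) w
    rw [relComplex_d_relMk] at hw
    exact ⟨b, b.2, (relMk_eq_iff c (chainsBoundary F L n b)).1 hw.symm⟩
  · rintro ⟨b, hb, h⟩
    refine ⟨relMk F L M (n + 1) ⟨b, hb⟩, ?_⟩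
    rw [relComplex_d_relMk]
    exact ((relMk_eq_iff c (chainsBoundary F L n ⟨b, hb⟩)).2 h).symm

theorem isAcyclicPair_of_subsingleton (h : ∀ k, Subsingleton (relHomology F L M k)) :
    IsAcyclicPair F L M := fun n c hc hb =>
  (exists_relComplex_d_eq_relMk_iff ⟨c, hc⟩).1
    (HomologicalComplex.moduleCat_exists_of_subsingleton_homology (by simp) rfl (h n) _
      ((relComplex_d_relMk_eq_zero_iff rfl ⟨c, hc⟩).2 hb))

/-- A criterion in terms of chains for an inclusion of pairs to induce an isomorphism. -/
theorem isIso_relHomologyMap (hL : L ≤ L') (hM : M ≤ M') (k : ℕ)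
    (hinj : ∀ c ∈ chains F L k, HasBoundaryIn F M k c →
      (∃ b ∈ chains F L' (k + 1), c - boundary F b ∈ chains F M' k) →
      ∃ b ∈ chains F L (k + 1), c - boundary F b ∈ chains F M k)
    (hsurj : ∀ c ∈ chains F L' k, HasBoundaryIn F M' k c →
      ∃ a ∈ chains F L k, HasBoundaryIn F M k a ∧
        ∃ b ∈ chains F L' (k + 1), a - c - boundary F b ∈ chains F M' k) :
    IsIso (relHomologyMap F hL hM k) := by
  refine HomologicalComplex.moduleCat_isIso_homologyMap (relComplexMap F hL hM)
    (i := k + 1) (by simp) rfl ?_ ?_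
  · intro x hx hw
    obtain ⟨c, rfl⟩ := relMk_surjective _ _ _ x
    rw [relComplexMap_f_relMk] at hw
    exact (exists_relComplex_d_eq_relMk_iff c).2
      (hinj c c.2 ((relComplex_d_relMk_eq_zero_iff rfl c).1 hx)
        ((exists_relComplex_d_eq_relMk_iff _).1 hw))
  · intro y hy
    obtain ⟨c, rfl⟩ := relMk_surjective _ _ _ y
    obtain ⟨a, ha, hab, h⟩ := hsurj c c.2 ((relComplex_d_relMk_eq_zero_iff rfl c).1 hy)
    refine ⟨relMk F L M k ⟨a, ha⟩, (relComplex_d_relMk_eq_zero_iff rfl _).2 hab, ?_⟩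
    rw [relComplexMap_f_relMk, ← relMk_sub]
    exact (exists_relComplex_d_eq_relMk_iff _).2 h

end Homology

/-! ### Acyclic pairs: triples, excision and the isomorphism criterion -/

section Chains

variable {F : Type u} [Field F] {V : Type v} {L M L' M' N : PreAbstractSimplicialComplex V} {n : ℕ}

theorem mem_chains_inf {c : Finset V →₀ F} (hL : c ∈ chains F L n) (hM : c ∈ chains F M n) :
    c ∈ chains F (L ⊓ M) n := fun _ hσ => ⟨⟨(hL hσ).1, (hM hσ).1⟩, (hL hσ).2⟩

theorem exists_add_of_mem_chains_sup {c : Finset V →₀ F} (hc : c ∈ chains F (L ⊔ M) n) :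
    ∃ a ∈ chains F L n, ∃ b ∈ chains F M n, a + b = c := by
  have h : {σ | σ ∈ L ⊔ M ∧ σ.card = n + 1} =
      {σ | σ ∈ L ∧ σ.card = n + 1} ∪ {σ | σ ∈ M ∧ σ.card = n + 1} :=
    Set.ext fun σ => or_and_right
  rw [chains, h, Finsupp.supported_union] at hc
  exact Submodule.mem_sup.1 hc

variable [LinearOrder V]

theorem HasBoundaryIn.mono {c : Finset V →₀ F} (h : HasBoundaryIn F M n c) (hM : M ≤ M') :
    HasBoundaryIn F M' n c := fun m hm => chains_mono F hM m (h m hm)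

theorem hasBoundaryIn_of_mem_chains {c : Finset V →₀ F} (hc : c ∈ chains F M n) :
    HasBoundaryIn F M n c := by
  rintro m rfl
  exact boundary_mem_chains F M m c hc

theorem HasBoundaryIn.sub {a c : Finset V →₀ F} (ha : HasBoundaryIn F M n a)
    (hc : HasBoundaryIn F M n c) : HasBoundaryIn F M n (a - c) := fun m hm => by
  rw [map_sub]
  exact sub_mem (ha m hm) (hc m hm)

theorem HasBoundaryIn.inf {c : Finset V →₀ F} (hL : HasBoundaryIn F L n c)
    (hM : HasBoundaryIn F M n c) : HasBoundaryIn F (L ⊓ M) n c :=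
  fun m hm => mem_chains_inf (hL m hm) (hM m hm)

theorem hasBoundaryIn_boundary (c : Finset V →₀ F) : HasBoundaryIn F M n (boundary F c) :=
  fun m _ => by
    rw [boundary_boundary]
    exact zero_mem _

theorem IsAcyclicPair.refl (L : PreAbstractSimplicialComplex V) : IsAcyclicPair F L L :=
  fun n c hc _ => ⟨0, zero_mem _, by simpa using hc⟩

/-- A relative cycle is first pushed from `L` into `M` by subtracting a boundary. This does not
change its own boundary, so acyclicity of `(M, N)` applies to the result. -/
theorem IsAcyclicPair.trans (hLM : M ≤ L) (hMN : N ≤ M) (h₁ : IsAcyclicPair F L M)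
    (h₂ : IsAcyclicPair F M N) : IsAcyclicPair F L N := by
  intro n c hc hb
  obtain ⟨b₁, hb₁, h⟩ := h₁ n c hc (hb.mono hMN)
  obtain ⟨b₂, hb₂, h'⟩ := h₂ n _ h (hb.sub (hasBoundaryIn_boundary b₁))
  exact ⟨b₁ + b₂, add_mem hb₁ (chains_mono F hLM _ hb₂), by
    rwa [map_add, ← sub_sub]⟩

/-- Excision. -/
theorem IsAcyclicPair.sup (h : IsAcyclicPair F L (L ⊓ M)) : IsAcyclicPair F (L ⊔ M) M := by
  intro n c hc hb
  obtain ⟨a, ha, e, he, rfl⟩ := exists_add_of_mem_chains_sup hc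
  -- The part `a` of `c` in `L` differs from `c` by a chain of `M`, so its boundary lies in both `L`
  -- and `M`.
  have hab : HasBoundaryIn F M n a := by
    simpa using hb.sub (hasBoundaryIn_of_mem_chains he)
  obtain ⟨b, hb, h'⟩ := h n a ha ((hasBoundaryIn_of_mem_chains ha).inf hab)
  refine ⟨b, chains_mono F le_sup_left _ hb, ?_⟩
  rw [add_sub_right_comm]
  exact add_mem (chains_mono F inf_le_right _ h') he

/-- Acyclicity of `(L, L' ⊔ M)` moves chains of `L` into `L' ⊔ M`, where they split into a part in
`L'` and a part in `M`; acyclicity of `(L' ⊓ M, M')` then corrects the part in `L'` modulo `M'`. -/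
theorem isIso_relHomologyMap_of_isAcyclicPair (hL : L' ≤ L) (hM : M' ≤ M)
    (h₁ : IsAcyclicPair F (L' ⊓ M) M') (h₂ : IsAcyclicPair F L (L' ⊔ M))
    (k : ℕ) : IsIso (relHomologyMap F hL hM k) := by
  apply isIso_relHomologyMap
  · rintro c hc hcb ⟨b, hb, he⟩
    -- The boundary of `b` is `c - (c - ∂b)`, a chain of `L'` minus a chain of `M`, so `b` is a
    -- cycle relative to `L' ⊔ M`.
    obtain ⟨b', hb', h⟩ := h₂ (k + 1) b hb (by
      rintro m hm
      obtain rfl : k = m := by omega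
      have := sub_mem (chains_mono F le_sup_left _ hc)
        (chains_mono F (le_sup_right : M ≤ L' ⊔ M) _ he)
      rwa [sub_sub_cancel] at this)
    obtain ⟨b₁, hb₁, b₂, hb₂, h⟩ := exists_add_of_mem_chains_sup h
    have hbb : boundary F b = boundary F b₁ + boundary F b₂ := by
      rw [← map_add, h, map_sub, boundary_boundary, sub_zero]
    have hcM : c - boundary F b₁ ∈ chains F M k := by
      have := add_mem he (boundary_mem_chains F M k b₂ hb₂)
      rwa [hbb, ← sub_sub, sub_add_cancel] at this
    have hcL : c - boundary F b₁ ∈ chains F L' k :=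
      sub_mem hc (boundary_mem_chains F L' k b₁ hb₁)
    obtain ⟨b₃, hb₃, h₃⟩ := h₁ k _ (mem_chains_inf hcL hcM)
      (hcb.sub (hasBoundaryIn_boundary b₁))
    exact ⟨b₁ + b₃, add_mem hb₁ (chains_mono F inf_le_left _ hb₃), by
      rwa [map_add, ← sub_sub]⟩
  · intro c hc hcb
    obtain ⟨b, hb, h⟩ := h₂ k c hc (hcb.mono le_sup_right)
    obtain ⟨c₁, hc₁, c₂, hc₂, h⟩ := exists_add_of_mem_chains_sup h
    have hc₁b : HasBoundaryIn F (L' ⊓ M) k c₁ := by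
      refine (hasBoundaryIn_of_mem_chains hc₁).inf ?_
      rw [eq_sub_of_add_eq h]
      exact (hcb.sub (hasBoundaryIn_boundary b)).sub (hasBoundaryIn_of_mem_chains hc₂)
    -- The boundary of `c₁` lies in `L' ⊓ M` but must lie in `M'`. It is itself a cycle, hence a
    -- boundary in `L' ⊓ M` modulo `M'`; the correction `b₂` is a chain of `M`, so it does not
    -- affect the class modulo `M`.
    obtain ⟨b₂, hb₂, hb₂'⟩ : ∃ b₂ ∈ chains F (L' ⊓ M) k, HasBoundaryIn F M' k (c₁ - b₂) := by
      cases k with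
      | zero => exact ⟨0, zero_mem _, fun m hm => by omega⟩
      | succ k =>
        obtain ⟨b₂, hb₂, h⟩ := h₁ k _ (hc₁b k rfl) (hasBoundaryIn_boundary c₁)
        refine ⟨b₂, hb₂, fun m hm => ?_⟩
        obtain rfl : k = m := by omega
        rwa [map_sub]
    refine ⟨c₁ - b₂, sub_mem hc₁ (chains_mono F inf_le_left _ hb₂), hb₂', -b, neg_mem hb, ?_⟩
    have : c₁ - b₂ - c - boundary F (-b) = -(b₂ + c₂) := by
      rw [map_neg, eq_sub_of_add_eq h]
      abel
    rw [this]
    exact neg_mem (add_mem (chains_mono F inf_le_right _ hb₂) hc₂)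

end Chains

/-! ### Multivectors without essential solutions, and index pairs -/

section Dynamics

variable {V : Type v} {K : PreAbstractSimplicialComplex V}

theorem toComplex_inf (A B : LowerSet ↥K) : toComplex (A ⊓ B) = toComplex A ⊓ toComplex B :=
  PreAbstractSimplicialComplex.ext (Set.image_inter Subtype.val_injective)

theorem toComplex_sup (A B : LowerSet ↥K) : toComplex (A ⊔ B) = toComplex A ⊔ toComplex B :=
  PreAbstractSimplicialComplex.ext (Set.image_union _ _ _)

namespace MultivectorField

variable (𝒱 : MultivectorField K)

variable {𝒱} in
theorem block_eq_of_mem {σ τ : ↥K} (h : τ ∈ 𝒱.block σ) : 𝒱.block τ = 𝒱.block σ :=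
  (𝒱.isPartition.2 τ).unique ⟨𝒱.block_mem_parts τ, 𝒱.mem_block τ⟩ ⟨𝒱.block_mem_parts σ, h⟩

variable {𝒱} in
theorem mem_block_symm {σ τ : ↥K} (h : τ ∈ 𝒱.block σ) : σ ∈ 𝒱.block τ := by
  rw [block_eq_of_mem h]
  exact 𝒱.mem_block σ

/-- A set is compatible with `𝒱` if it is a union of multivectors. -/
def IsCompatible (D : Set ↥K) : Prop :=
  ∀ σ ∈ D, 𝒱.block σ ⊆ D

variable {𝒱} in
theorem IsCompatible.diff {D D' : Set ↥K} (h : 𝒱.IsCompatible D) (h' : 𝒱.IsCompatible D') :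
    𝒱.IsCompatible (D \ D') := fun σ hσ _ hτ =>
  ⟨h σ hσ.1 hτ, fun hτ' => hσ.2 (h' _ hτ' (mem_block_symm hτ))⟩

theorem isCompatible_block (σ : ↥K) : 𝒱.IsCompatible (𝒱.block σ) :=
  fun _ hτ => (block_eq_of_mem hτ).subset

variable (F : Type u) [Field F] [LinearOrder V]

theorem inv_mono {A B : Set ↥K} (h : A ⊆ B) : 𝒱.inv F A ⊆ 𝒱.inv F B :=
  fun _ ⟨hσ, ρ, hρ, hA, hi⟩ => ⟨h hσ, ρ, hρ, fun i => h (hA i), hi⟩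

variable {𝒱 F}

/-- A constant solution in a critical multivector is essential. -/
theorem not_isCritical_of_inv_eq_empty {D : Set ↥K} (hD : 𝒱.inv F D = ∅) {σ : ↥K}
    (hσ : σ ∈ D) : ¬ IsCritical F (𝒱.block σ) (𝒱.block_convex σ) := fun h =>
  Set.eq_empty_iff_forall_notMem.1 hD σ
    ⟨hσ, fun _ => σ, ⟨fun _ => Or.inl (Set.mem_Iic.2 le_rfl), fun _ hi => absurd h hi⟩, fun _ => hσ, 0, rfl⟩

/-- If no essential solution stays in a non-empty union `D` of multivectors, then `D` contains a
multivector whose mouth does not meet `D`. -/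
theorem exists_minimal_block [Finite ↥K] {D : Set ↥K} (hc : 𝒱.IsCompatible D)
    (hD : 𝒱.inv F D = ∅) (hne : D.Nonempty) :
    ∃ σ ∈ D, ∀ τ ∈ lowerClosure (𝒱.block σ), τ ∈ D → τ ∈ 𝒱.block σ := by
  by_contra! hcon
  -- From `σ` a solution can move to `ρ` inside the multivector of `σ`, and then down to the face
  -- `τ` in another multivector.
  have hex : ∀ σ : D, ∃ (τ : D) (ρ : D), (τ : ↥K) ∉ 𝒱.block σ ∧ (ρ : ↥K) ∈ 𝒱.block σ ∧
      (τ : ↥K) ≤ ρ := by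
    rintro ⟨σ, hσ⟩
    obtain ⟨τ, hτ, hτD, hτσ⟩ := hcon σ hσ
    obtain ⟨ρ, hρ, hle⟩ := mem_lowerClosure.1 hτ
    exact ⟨⟨τ, hτD⟩, ⟨ρ, hc σ hσ hρ⟩, hτσ, hρ, hle⟩
  choose f g hf hg hfg using hex
  have := hne.to_subtype
  obtain ⟨a, ha⟩ := Function.exists_int_orbit f
  -- The solution runs `a i`, `g (a i)`, `a (i + 1) = f (a i)`, and so on. Integer division rounds
  -- down, so the formula is also right for negative times.
  let ρ : ℤ → D := fun j => if Even j then a (j / 2) else g (a (j / 2))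
  have hblock : ∀ j, 𝒱.block (ρ j) = 𝒱.block (a (j / 2)) := by
    intro j
    by_cases hj : Even j
    · simp only [ρ, if_pos hj]
    · simp only [ρ, if_neg hj]
      exact block_eq_of_mem (hg _)
  have hne : ∀ i, 𝒱.block (a i) ≠ 𝒱.block (a (i + 1)) := by
    intro i h
    rw [ha] at h
    exact hf (a i) (h ▸ 𝒱.mem_block (f (a i)))
  -- Times two apart belong to consecutive terms of `a`, hence to different multivectors; `j - 2`
  -- and `j + 2` therefore witness essentiality at `j`.
  refine Set.eq_empty_iff_forall_notMem.1 hD (ρ 0)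
    ⟨(ρ 0).2, fun j => ρ j, ⟨fun j => ?_, fun j _ => ⟨j - 2, j + 2, by omega, by omega, ?_, ?_⟩⟩,
      fun j => (ρ j).2, 0, rfl⟩
  · rcases Int.even_or_odd' j with ⟨i, rfl | rfl⟩
    · right
      have h₁ : ρ (2 * i) = a i := by simp [ρ]
      have h₂ : ρ (2 * i + 1) = g (a i) := by
        have : (2 * i + 1) / 2 = i := by omega
        simp [ρ, this]
      beta_reduce
      rw [h₁, h₂]
      exact hg _
    · left
      have h₁ : ρ (2 * i + 1) = g (a i) := by
        have : (2 * i + 1) / 2 = i := by omega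
        simp [ρ, this]
      have h₂ : ρ (2 * i + 1 + 1) = f (a i) := by
        have h : 2 * i + 1 + 1 = 2 * (i + 1) := by ring
        rw [h, ← ha]
        simp [ρ]
      beta_reduce
      rw [h₁, h₂]
      exact hfg _
  · rw [hblock, hblock]
    have h : j / 2 = (j - 2) / 2 + 1 := by omega
    rw [h]
    exact hne _
  · rw [hblock, hblock]
    have h : (j + 2) / 2 = j / 2 + 1 := by omega
    rw [h]
    exact hne _

/-- The induction enlarges `R` by the closure of a multivector with no other simplex of `Q \ R` in
its closure; `Q \ R` then loses exactly that multivector, so both hypotheses persist. -/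
theorem isAcyclicPair_of_inv_eq_empty [Finite ↥K] {Q : LowerSet ↥K} (R : LowerSet ↥K)
    (hRQ : R ≤ Q) (hc : 𝒱.IsCompatible ((Q : Set ↥K) \ R))
    (hD : 𝒱.inv F ((Q : Set ↥K) \ R) = ∅) :
    IsAcyclicPair F (toComplex Q) (toComplex R) := by
  have : Finite (LowerSet ↥K) := Finite.of_injective _ SetLike.coe_injective
  induction R using WellFoundedGT.induction with
  | ind R ih =>
    rcases Set.eq_empty_or_nonempty ((Q : Set ↥K) \ R) with hQR | hne
    · rw [le_antisymm hRQ (Set.sdiff_eq_empty.1 hQR)]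
      exact IsAcyclicPair.refl _
    obtain ⟨σ, hσ, hmin⟩ := exists_minimal_block hc hD hne
    have hWQ : lowerClosure (𝒱.block σ) ≤ Q :=
      lowerClosure_le.2 fun τ hτ => (hc σ hσ hτ).1
    -- The multivector is disjoint from `R`, and by minimality the rest of its closure lies in `R`.
    -- This makes the excised pair the one in the definition of criticality.
    have hmouth : lowerClosure (𝒱.block σ) ⊓ R = mouth (𝒱.block σ) (𝒱.block_convex σ) := by
      ext τ
      refine ⟨fun h => ⟨h.1, fun hτ => (hc σ hσ hτ).2 h.2⟩, fun h => ⟨h.1, ?_⟩⟩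
      by_contra hτ
      exact h.2 (hmin τ h.1 ⟨hWQ h.1, hτ⟩)
    have hdiff : (Q : Set ↥K) \ (lowerClosure (𝒱.block σ) ⊔ R : LowerSet ↥K) =
        ((Q : Set ↥K) \ R) \ 𝒱.block σ := by
      ext τ
      constructor
      · rintro ⟨hQ, hτ⟩
        exact ⟨⟨hQ, fun h => hτ (Or.inr h)⟩, fun h => hτ (Or.inl (subset_lowerClosure h))⟩
      · rintro ⟨hQ, hτ⟩
        exact ⟨hQ.1, fun h => h.elim (fun h => hτ (hmin τ h hQ)) hQ.2⟩
    refine IsAcyclicPair.trans (toComplex_mono (sup_le hWQ hRQ)) (toComplex_mono le_sup_right)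
      (ih (lowerClosure (𝒱.block σ) ⊔ R) ?_ (sup_le hWQ hRQ) ?_ ?_) ?_
    · refine lt_of_le_of_ne le_sup_right fun h => hσ.2 ?_
      rw [h]
      exact Or.inl (subset_lowerClosure (𝒱.mem_block σ))
    · rw [hdiff]
      exact hc.diff (𝒱.isCompatible_block σ)
    · rw [hdiff, ← Set.subset_empty_iff, ← hD]
      exact 𝒱.inv_mono F Set.sdiff_subset
    · rw [toComplex_sup]
      refine IsAcyclicPair.sup ?_
      rw [← toComplex_inf, hmouth]
      refine isAcyclicPair_of_subsingleton fun k => ?_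
      by_contra hk
      exact not_isCritical_of_inv_eq_empty hD hσ ⟨k, not_subsingleton_iff_nontrivial.1 hk⟩

/-- A multivector meeting `P \ E` stays in `P` because `F(P \ E) ⊆ P`. It cannot meet `E`, since
from there `F` would lead back to `σ`, and `F(E) ∩ P ⊆ E`. -/
theorem IsIndexPair.isCompatible_diff {S : Set ↥K} {P E : LowerSet ↥K}
    (h : 𝒱.IsIndexPair F S P E) : 𝒱.IsCompatible ((P : Set ↥K) \ E) := by
  intro σ hσ τ hτ
  refine ⟨h.image_diff_subset (Set.mem_biUnion hσ (Or.inr hτ)), fun hE => hσ.2 ?_⟩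
  exact h.image_inter_subset ⟨Set.mem_biUnion hE (Or.inr (mem_block_symm hτ)), hσ.1⟩

end MultivectorField

end Dynamics

end ConleyIndex

/-! ### Comparison of nested index pairs -/

theorem mainTheorem2 {F : Type*} [Field F] [Finite F] {V : Type*} [LinearOrder V]
    (K : PreAbstractSimplicialComplex V) [Finite ↥K]
    (𝒱 : ConleyIndex.MultivectorField K) (S : Set ↥K) (P E P' E' : LowerSet ↥K)
    (hPE : 𝒱.IsIndexPair F S P E) (hPE' : 𝒱.IsIndexPair F S P' E')
    (hP : P' ≤ P) (hE : E' ≤ E) (k : ℕ) :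
    CategoryTheory.IsIso (ConleyIndex.conleyIndexMap F hP hE k) := by
  have hc := hPE.isCompatible_diff
  have hc' := hPE'.isCompatible_diff
  have hinv : 𝒱.inv F ((P : Set ↥K) \ E) = 𝒱.inv F ((P' : Set ↥K) \ E') :=
    hPE.eq_inv.symm.trans hPE'.eq_inv
  apply ConleyIndex.isIso_relHomologyMap_of_isAcyclicPair
    (ConleyIndex.toComplex_mono hP) (ConleyIndex.toComplex_mono hE)
  · have hdiff : ((P' ⊓ E : LowerSet ↥K) : Set ↥K) \ E' =
        ((P' : Set ↥K) \ E') \ ((P : Set ↥K) \ E) := by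
      ext τ
      constructor
      · rintro ⟨h, hτ⟩
        exact ⟨⟨h.1, hτ⟩, fun h' => h'.2 h.2⟩
      · rintro ⟨h, hτ⟩
        exact ⟨⟨h.1, by_contra fun hτE => hτ ⟨hP h.1, hτE⟩⟩, h.2⟩
    rw [← ConleyIndex.toComplex_inf]
    refine ConleyIndex.MultivectorField.isAcyclicPair_of_inv_eq_empty (𝒱 := 𝒱) E'
      (le_inf hPE'.subset hE) (hdiff ▸ hc'.diff hc) ?_
    rw [hdiff]
    -- An invariant simplex of the difference would lie in the common invariant part, hence in the
    -- set `P \ E` that was removed.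
    refine Set.eq_empty_iff_forall_notMem.2 fun σ hσ => hσ.1.2 ?_
    have := 𝒱.inv_mono F Set.sdiff_subset hσ
    rw [← hinv] at this
    exact this.1
  · have hdiff : (P : Set ↥K) \ (P' ⊔ E : LowerSet ↥K) =
        ((P : Set ↥K) \ E) \ ((P' : Set ↥K) \ E') := by
      ext τ
      constructor
      · rintro ⟨h, hτ⟩
        exact ⟨⟨h, fun h => hτ (Or.inr h)⟩, fun h => hτ (Or.inl h.1)⟩
      · rintro ⟨h, hτ⟩
        exact ⟨h.1, fun h' => h'.elim (fun hτP => hτ ⟨hτP, fun hτE => h.2 (hE hτE)⟩) h.2⟩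
    rw [← ConleyIndex.toComplex_sup]
    refine ConleyIndex.MultivectorField.isAcyclicPair_of_inv_eq_empty (𝒱 := 𝒱) (P' ⊔ E)
      (sup_le hP hPE.subset) (hdiff ▸ hc.diff hc') ?_
    rw [hdiff]
    -- The same argument with the two index pairs exchanged.
    refine Set.eq_empty_iff_forall_notMem.2 fun σ hσ => hσ.1.2 ?_
    have := 𝒱.inv_mono F Set.sdiff_subset hσ
    rw [hinv] at this
    exact this.1
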